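/- Let $n\ge 0$ be an integer, $b\in\mathbb R$, $s>n/2+1$ and $r\le s$. Let $A$ be an invertible (bijective) real-linear operator on the space $\mathcal S'(\mathbb R^n,\mathbb C^n)$ of tempered distributions which has order $r$ on $H^s$, i.e. maps $H^s$ into $H^{s-r}$ (for instance an elliptic Fourier multiplier of order $r$). Let $J\subset\mathbb R$ be an open interval containing $0$, and let $u:J\times\mathbb R^n\to\mathbb R^n$ be an $H^s$ time-dependent vector field, i.e. $u\in C^0(J,H^s(\mathbb R^n,\mathbb R^n))$, each $u(t)$ being identified with its continuous (hence $C^1$) representative. Let $\varphi$ be the Lagrangian flow of $u$, that is, a family of bijections $\varphi(t):\mathbb R^n\to\mathbb R^n$ with $\varphi(0)=\mathrm{id}$ and $\partial_t\varphi(t,x)=u(t,\varphi(t,x))$ for all $t\in J$, $x\in\mathbb R^n$, and put $v:=u\circ\varphi$, i.e. $v(t,x)=u(t,\varphi(t,x))$. Then $u$ solves the $b$-equation $$u_t=-A^{-1}\bigl(\nabla_u(Au)+(\nabla u)^T(Au)+(b-1)\operatorname{div}(u)\,Au\bigr)$$ on $J$ if and only if $(\varphi,v)$ solves on $J$ the system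 $$\varphi_t=v,\qquad v_t=S_\varphi(v),$$ where $S_\varphi=R_\varphi\circ S\circ R_{\varphi^{-1}}$, $R_\varphi f=f\circ\varphi$, and $$S(u)=A^{-1}\bigl([A,\nabla_u]u-(\nabla u)^T(Au)-(b-1)\operatorname{div}(u)\,Au\bigr),\qquad [A,\nabla_u]u=A(\nabla_uu)-\nabla_u(Au).$$ Here $((\nabla u)^Tw)^i=\sum_j(\partial_iu^j)w^j$, the expressions inside $A^{-1}(\cdot)$ are taken in the sense of distributions (with $\nabla_uw=\sum_j\partial_j(u^jw)-\operatorname{div}(u)\,w$ for $w=Au\in H^{s-r}\subset L^2$), and $\varphi_t,v_t,u_t$ are partial derivatives in $t$ at each point $x$: a solution is required to have, for every $t\in J$, the partial derivative at every $x\in\mathbb R^n$, and the right-hand side of the $b$-equation at time $t$ (respectively the distribution $S(v\circ\varphi^{-1})$) is required to be a continuous square-integrable $\mathbb R^n$-valued function, whose value at $x$ (respectively at $\varphi(t,x)$) equals $u_t(t,x)$ (respectively $v_t(t,x)$). -/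

import Mathlib

open MeasureTheory
open scoped LineDeriv

noncomputable section

namespace BEquation

/-- The Euclidean space `ℝⁿ`. -/
abbrev Rn (n : ℕ) : Type := EuclideanSpace ℝ (Fin n)

/-- The Hermitian space `ℂⁿ`. -/
abbrev Cn (n : ℕ) : Type := EuclideanSpace ℂ (Fin n)

/-- Tempered distributions on `ℝⁿ` with values in `ℂⁿ`. -/
abbrev Distr (n : ℕ) : Type := TemperedDistribution (Rn n) (Cn n)

/-- The inclusion `ℝⁿ ⊆ ℂⁿ`. -/
def toComplex {n : ℕ} (y : Rn n) : Cn n := WithLp.toLp 2 fun i => (y i : ℂ)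

open Classical in
/-- The tempered distribution defined by a square integrable function
(and `0` if the function is not square integrable). -/
def distOf {n : ℕ} (w : Rn n → Cn n) : Distr n :=
  if h : MemLp w 2 (volume : Measure (Rn n)) then
    Lp.toTemperedDistribution (h.toLp w) else 0

/-- The tempered distribution defined by a (square integrable) real vector field. -/
def fieldDist {n : ℕ} (f : Rn n → Rn n) : Distr n := distOf fun x => toComplex (f x)

/-- The continuous square integrable real vector field `g` is the distribution `T`.
For given `T` there is at most one such `g`. -/
def IsFieldOf {n : ℕ} (g : Rn n → Rn n) (T : Distr n) : Prop :=
  Continuous g ∧ MemLp g 2 (volume : Measure (Rn n)) ∧ fieldDist g = T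

open Classical in
/-- The `L²` function representing a distribution in `H⁰ = L²` (and `0` for other distributions). -/
def l2Rep {n : ℕ} (T : Distr n) : Rn n → Cn n :=
  if h : ∃ w : Lp (Cn n) 2 (volume : Measure (Rn n)), Lp.toTemperedDistribution w = T then
    (h.choose : Rn n → Cn n) else 0

/-- `u` is an `H^s` time-dependent vector field on the time interval `J`, that is, an element
of `C⁰(J, H^s(ℝⁿ, ℝⁿ))`. Each `u t` is a square integrable field, given by its continuous
representative; `U t` is its image `(1 - Δ / (4π²))^{s/2} (u t)` under the isometry of `H^s`
onto `L²`, so that continuity of `U` in `L²` is continuity of `u` in `H^s`. -/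
def IsSobolevVectorField {n : ℕ} (s : ℝ) (J : Set ℝ) (u : ℝ → Rn n → Rn n) : Prop :=
  (∀ t ∈ J, Continuous (u t) ∧ MemLp (u t) 2 (volume : Measure (Rn n))) ∧
  ∃ U : ℝ → Lp (Cn n) 2 (volume : Measure (Rn n)),
    (∀ t ∈ J, TemperedDistribution.besselPotential (Rn n) (Cn n) s (fieldDist (u t)) =
      Lp.toTemperedDistribution (U t)) ∧
    ContinuousOn U J

/-- The `i`-th vector of the standard basis. -/
def e {n : ℕ} (i : Fin n) : Rn n := EuclideanSpace.single i 1

/-- The partial derivative `∂ᵢ uʲ (x)`. -/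
def partialDeriv {n : ℕ} (u : Rn n → Rn n) (i j : Fin n) (x : Rn n) : ℝ :=
  (fderiv ℝ u x (e i)) j

/-- The divergence `∑ᵢ ∂ᵢ uⁱ`. -/
def divergence {n : ℕ} (u : Rn n → Rn n) (x : Rn n) : ℝ := ∑ i, partialDeriv u i i x

/-- The covariant derivative `∇_u u` of a `C¹` vector field along itself. -/
def selfTransport {n : ℕ} (u : Rn n → Rn n) (x : Rn n) : Rn n := fderiv ℝ u x (u x)

/-- `∇_u w = ∑ⱼ uʲ ∂ⱼ w` for a bounded `C¹` field `u` with bounded derivative and an `L²` function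
`w`, as a distribution: `∑ⱼ uʲ ∂ⱼ w = ∑ⱼ ∂ⱼ (uʲ w) - div(u) w`. -/
def transport {n : ℕ} (u : Rn n → Rn n) (w : Rn n → Cn n) : Distr n :=
  (∑ j, ∂_{(e j : Rn n)} (distOf fun x => ((u x j : ℝ) : ℂ) • w x)) -
    distOf fun x => (divergence u x : ℂ) • w x

/-- `(∇u)ᵀ w`, with components `∑ⱼ (∂ᵢ uʲ) wʲ`. -/
def gradTranspose {n : ℕ} (u : Rn n → Rn n) (w : Rn n → Cn n) : Distr n :=
  distOf fun x => WithLp.toLp 2 fun i => ∑ j, (partialDeriv u i j x : ℂ) * w x j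

/-- `div(u) w`. -/
def divMul {n : ℕ} (u : Rn n → Rn n) (w : Rn n → Cn n) : Distr n :=
  distOf fun x => (divergence u x : ℂ) • w x

variable {n : ℕ} (A : Distr n ≃ₗ[ℝ] Distr n) (b : ℝ)

/-- The momentum `A u` of an `H^s` field `u`, as an `L²` function. -/
def momentum (u : Rn n → Rn n) : Rn n → Cn n := l2Rep (A (fieldDist u))

/-- The right-hand side `-A⁻¹ (∇_u (A u) + (∇u)ᵀ (A u) + (b - 1) div(u) A u)` of the
`b`-equation. -/
def bRHS (u : Rn n → Rn n) : Distr n :=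
  -A.symm (transport u (momentum A u) + gradTranspose u (momentum A u) +
    (b - 1) • divMul u (momentum A u))

/-- `u` solves the `b`-equation
`u_t = -A⁻¹ (∇_u (A u) + (∇u)ᵀ (A u) + (b - 1) div(u) A u)` on `J`. -/
def IsBSolution (J : Set ℝ) (u : ℝ → Rn n → Rn n) : Prop :=
  ∀ t ∈ J, ∃ g : Rn n → Rn n, IsFieldOf g (bRHS A b (u t)) ∧
    ∀ x, HasDerivAt (fun τ => u τ x) (g x) t

/-- The commutator `[A, ∇_u] u = A (∇_u u) - ∇_u (A u)`. -/
def commutator (u : Rn n → Rn n) : Distr n :=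
  A (fieldDist (selfTransport u)) - transport u (momentum A u)

/-- `S(u) = A⁻¹ ([A, ∇_u] u - (∇u)ᵀ (A u) - (b - 1) div(u) A u)`. -/
def spray (u : Rn n → Rn n) : Distr n :=
  A.symm (commutator A u - gradTranspose u (momentum A u) -
    (b - 1) • divMul u (momentum A u))

/-- `h = S_φ(v)` where `S_φ = R_φ ∘ S ∘ R_{φ⁻¹}` and `R_φ f = f ∘ φ`: the distribution `S(v ∘ φ⁻¹)`
is a continuous field `g`, and `h = g ∘ φ`. -/
def IsTwistedSpray (φ : Rn n ≃ Rn n) (v h : Rn n → Rn n) : Prop :=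
  ∃ g : Rn n → Rn n, IsFieldOf g (spray A b (v ∘ φ.symm)) ∧ h = g ∘ φ

/-- `(φ, v)` solves `φ_t = v`, `v_t = S_φ(v)` on `J`. -/
def IsSpraySolution (J : Set ℝ) (φ : ℝ → Rn n ≃ Rn n) (v : ℝ → Rn n → Rn n) : Prop :=
  (∀ t ∈ J, ∀ x, HasDerivAt (fun τ => φ τ x) (v t x) t) ∧
  ∀ t ∈ J, ∃ h : Rn n → Rn n, IsTwistedSpray A b (φ t) (v t) h ∧
    ∀ x, HasDerivAt (fun τ => v τ x) (h x) t

/-- `φ` is the Lagrangian flow of `u` on `J`: `φ(0) = id` and `φ_t = u ∘ φ`. -/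
def IsLagrangianFlow (J : Set ℝ) (u : ℝ → Rn n → Rn n) (φ : ℝ → Rn n ≃ Rn n) : Prop :=
  (∀ x, φ 0 x = x) ∧
  ∀ t ∈ J, ∀ x, HasDerivAt (fun τ => φ τ x) (u t (φ t x)) t

end BEquation

end

open MeasureTheory
open scoped LineDeriv

noncomputable section

namespace BEquation

/-! ### Sobolev embedding of `H^s` into `C¹` by Fourier inversion. -/

section SobolevEmbedding

open FourierTransform TemperedDistribution Module
open scoped SchwartzMap

variable {E F : Type*} [NormedAddCommGroup E] [InnerProductSpace ℝ E] [FiniteDimensional ℝ E]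
  [MeasurableSpace E] [BorelSpace E]

/-! Since `A⁻¹ A (∇_u u) = ∇_u u`, the spray equals the right-hand side of the b-equation plus `∇_u
u` (`spray_eq`). On the other hand the chain rule for `v = u ∘ φ` reads `v_t = (u_t + ∇_u u) ∘ φ`.
So the two equations are one identity, read at `x` or at `φ(t, x)`, and `φ(t)` is onto.

The chain rule must hold in both directions, without knowing in advance that `u_t` or `v_t` exists.
The key is that `u(τ, φ(τ, x)) - u(τ, φ(t, x))` always has derivative `∇_u u` at `τ = t`
(`hasDerivAt_comp_curve_sub`). This needs `Du(τ) → Du(t)` uniformly in space, which follows from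
continuity in `H^s` and the embedding into `C¹`, where `s > n/2 + 1` enters. -/

theorem memLp_two_one_add_norm_sq_rpow {σ : ℝ} (hσ : (finrank ℝ E : ℝ) < 2 * σ) :
    MemLp (fun x : E => (((1 + ‖x‖ ^ 2) ^ (-σ / 2) : ℝ) : ℂ)) 2 := by
  have hc : Continuous fun x : E => (((1 + ‖x‖ ^ 2) ^ (-σ / 2) : ℝ) : ℂ) := by
    refine Complex.continuous_ofReal.comp (Continuous.rpow_const (by fun_prop) fun x => ?_)
    exact Or.inl (by positivity)
  rw [memLp_two_iff_integrable_sq_norm hc.aestronglyMeasurable]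
  refine (integrable_rpow_neg_one_add_norm_sq hσ).congr (Filter.Eventually.of_forall fun x => ?_)
  have h0 : (0 : ℝ) ≤ 1 + ‖x‖ ^ 2 := by positivity
  simp only [Complex.norm_real, Real.norm_eq_abs, sq_abs]
  rw [← Real.rpow_mul_natCast h0]
  congr 1
  push_cast
  ring

variable [NormedAddCommGroup F] [InnerProductSpace ℂ F]

/-- The weight `(1 + ‖x‖²)^{-σ/2}`, `σ > dim / 2`, maps `L²` boundedly into `L¹`. -/
theorem integrable_weight_smul {σ : ℝ} (hσ : (finrank ℝ E : ℝ) < 2 * σ) :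
    ∃ C : ℝ, 0 ≤ C ∧ ∀ W : Lp F 2 (volume : Measure E),
      Integrable (fun x => (((1 + ‖x‖ ^ 2) ^ (-σ / 2) : ℝ) : ℂ) • W x) ∧
      ∫ x, ‖(((1 + ‖x‖ ^ 2) ^ (-σ / 2) : ℝ) : ℂ) • W x‖ ≤ C * ‖W‖ := by
  have hw := memLp_two_one_add_norm_sq_rpow (E := E) hσ
  refine ⟨‖hw.toLp‖, norm_nonneg _, fun W => ?_⟩
  -- Hölder with `1/2 + 1/2 = 1`: the product of two `L²` functions, viewed in `L¹`.
  have hae : ((hw.toLp • W : Lp F 1 (volume : Measure E)) : E → F) =ᵐ[volume]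
      fun x => (((1 + ‖x‖ ^ 2) ^ (-σ / 2) : ℝ) : ℂ) • W x := by
    filter_upwards [Lp.coeFn_lpSMul (r := 1) hw.toLp W, hw.coeFn_toLp] with x h1 h2
    rw [h1, Pi.smul_apply', h2]
  refine ⟨(L1.integrable_coeFn _).congr hae, ?_⟩
  calc ∫ x, ‖(((1 + ‖x‖ ^ 2) ^ (-σ / 2) : ℝ) : ℂ) • W x‖
      = ∫ x, ‖(hw.toLp • W : Lp F 1 (volume : Measure E)) x‖ := by
        refine integral_congr_ae ?_
        filter_upwards [hae] with x hx
        rw [hx]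
    _ = ‖(hw.toLp • W : Lp F 1 (volume : Measure E))‖ := (L1.norm_eq_integral_norm _).symm
    _ ≤ ‖hw.toLp‖ * ‖W‖ := Lp.norm_smul_le _ _

variable [CompleteSpace F]

/-- On the Fourier side the Bessel potential is multiplication by `(1 + ‖x‖²)^{s/2}`, which the
inverse weight cancels. -/
theorem fourier_eq_smulLeftCLM_of_besselPotential {s : ℝ} {f : 𝓢'(E, F)}
    {W : Lp F 2 (volume : Measure E)}
    (h : besselPotential E F s f = Lp.toTemperedDistribution W) :
    𝓕 f = smulLeftCLM F (fun x : E => (((1 + ‖x‖ ^ 2) ^ (-s / 2) : ℝ) : ℂ))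
      (Lp.toTemperedDistribution (𝓕 W)) := by
  rw [← Lp.fourier_toTemperedDistribution_eq, ← h,
    fourier_besselPotential_eq_smulLeftCLM_fourier_apply,
    smulLeftCLM_smulLeftCLM_apply (by fun_prop) (by fun_prop)]
  convert! (smulLeftCLM_const 1 (𝓕 f)).symm using 1
  · simp
  · congr
    ext x
    rw [Pi.mul_apply]
    norm_cast
    rw [← Real.rpow_add (by positivity)]
    ring_nf
    simp

/-- The multiplication formula `∫ ĝ h = ∫ g ĥ`; the reflection turns `𝓕⁻` into `𝓕`. -/
theorem integral_fourierInv_smul (g : 𝓢(E, ℂ)) {h : E → F} (hh : Integrable h) :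
    ∫ x, (𝓕⁻ g) x • h x = ∫ x, g x • 𝓕 (fun y => h (-y)) x := by
  have hh' : Integrable fun y => h (-y) := hh.comp_neg
  calc ∫ x, (𝓕⁻ g) x • h x = ∫ x, 𝓕 (g : E → ℂ) (-x) • h x := by
        refine integral_congr_ae (Filter.Eventually.of_forall fun x => ?_)
        simp only [SchwartzMap.fourierInv_coe, Real.fourierInv_eq_fourier_neg]
    _ = ∫ x, 𝓕 (g : E → ℂ) x • h (-x) := by
        rw [← integral_neg_eq_self (fun x => 𝓕 (g : E → ℂ) x • h (-x))]
        simp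
    _ = ∫ x, g x • 𝓕 (fun y => h (-y)) x := by
        simpa using! VectorFourier.integral_fourierIntegral_smul_eq_flip (L := innerₗ E)
          Real.continuous_fourierChar continuous_inner g.integrable hh'

/-- A continuous square integrable function whose Bessel potential is the `L²` function `W`
is a Fourier integral. -/
theorem eq_fourier_of_besselPotential {s : ℝ} (hs : (finrank ℝ E : ℝ) < 2 * s) {f : E → F}
    (hf : Continuous f) (hf2 : MemLp f 2) {W : Lp F 2 (volume : Measure E)}
    (h : besselPotential E F s (Lp.toTemperedDistribution hf2.toLp) =
      Lp.toTemperedDistribution W) :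
    f = 𝓕 (fun y : E => (((1 + ‖-y‖ ^ 2) ^ (-s / 2) : ℝ) : ℂ) • (𝓕 W : Lp F 2 volume) (-y)) := by
  obtain ⟨C, -, hC⟩ := integrable_weight_smul (E := E) (F := F) hs
  set k : E → F := fun y => (((1 + ‖y‖ ^ 2) ^ (-s / 2) : ℝ) : ℂ) • (𝓕 W : Lp F 2 volume) y with hk
  have hki : Integrable k := (hC _).1
  change f = 𝓕 (fun y => k (-y))
  have hcont : Continuous (𝓕 (fun y => k (-y))) :=
    VectorFourier.fourierIntegral_continuous Real.continuous_fourierChar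
      (L := innerₗ E) continuous_inner hki.comp_neg
  -- Both sides are continuous, so it suffices to test them against smooth compactly supported
  -- functions.
  refine Continuous.ae_eq_iff_eq volume hf hcont |>.1 ?_
  refine ae_eq_of_integral_contDiff_smul_eq (hf2.locallyIntegrable (by norm_num))
    hcont.locallyIntegrable fun g g_smooth g_cpt => ?_
  have hg₁ : HasCompactSupport (Complex.ofRealCLM ∘ g) := g_cpt.comp_left rfl
  have hg₂ : ContDiff ℝ (⊤ : ℕ∞) (Complex.ofRealCLM ∘ g) := by fun_prop
  set G : 𝓢(E, ℂ) := hg₁.toSchwartzMap hg₂ with hG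
  have hGx : ∀ x, G x = (g x : ℂ) := fun x => rfl
  have h1 : (Lp.toTemperedDistribution hf2.toLp : 𝓢'(E, F)) G = ∫ x, g x • f x := by
    rw [Lp.toTemperedDistribution_apply]
    refine integral_congr_ae ?_
    filter_upwards [hf2.coeFn_toLp] with x hx
    rw [hx, hGx, Complex.coe_smul]
  have h2 : (Lp.toTemperedDistribution hf2.toLp : 𝓢'(E, F)) G =
      ∫ x, g x • 𝓕 (fun y => k (-y)) x := by
    have hinv : 𝓕⁻ (𝓕 (Lp.toTemperedDistribution hf2.toLp : 𝓢'(E, F))) =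
        (Lp.toTemperedDistribution hf2.toLp : 𝓢'(E, F)) := fourierInv_fourier_eq _
    rw [← hinv, fourier_eq_smulLeftCLM_of_besselPotential h, TemperedDistribution.fourierInv_apply,
      smulLeftCLM_apply_apply, Lp.toTemperedDistribution_apply]
    calc _ = ∫ x, (𝓕⁻ G) x • k x := by
          refine integral_congr_ae (Filter.Eventually.of_forall fun x => ?_)
          simp only [hk]
          rw [SchwartzMap.smulLeftCLM_apply_apply (by fun_prop), smul_smul, smul_eq_mul, mul_comm]
      _ = _ := by
          rw [integral_fourierInv_smul G hki]
          refine integral_congr_ae (Filter.Eventually.of_forall fun x => ?_)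
          simp only [hGx, Complex.coe_smul]
  rw [← h1, h2]

/-- The Sobolev embedding of `H^s` into `C¹` for `s > dim / 2 + 1`. -/
theorem contDiff_one_of_besselPotential {s : ℝ} (hs : (finrank ℝ E : ℝ) / 2 + 1 < s) :
    ∃ C : ℝ, ∀ (f : E → F) (hf2 : MemLp f 2) (W : Lp F 2 (volume : Measure E)),
      Continuous f →
      besselPotential E F s (Lp.toTemperedDistribution hf2.toLp) = Lp.toTemperedDistribution W →
      ContDiff ℝ 1 f ∧ ∀ x, ‖fderiv ℝ f x‖ ≤ C * ‖W‖ := by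
  obtain ⟨C₀, -, hC₀⟩ := integrable_weight_smul (E := E) (F := F) (σ := s) (by linarith)
  obtain ⟨C, hC0, hC⟩ := integrable_weight_smul (E := E) (F := F) (σ := s - 1) (by linarith)
  -- The factor `2π` comes from differentiating the Fourier character, `C` from the weight of order
  -- `s - 1`.
  refine ⟨2 * Real.pi * ‖innerSL ℝ (E := E)‖ * C, fun f hf2 W hf hW => ?_⟩
  set H : E → F := fun y : E =>
    (((1 + ‖-y‖ ^ 2) ^ (-s / 2) : ℝ) : ℂ) • (𝓕 W : Lp F 2 volume) (-y) with hH
  have hfH : f = 𝓕 H := eq_fourier_of_besselPotential (by linarith) hf hf2 hW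
  have hHi : Integrable H := (hC₀ (𝓕 W)).1.comp_neg
  set K : E → F := fun y : E =>
    (((1 + ‖-y‖ ^ 2) ^ (-(s - 1) / 2) : ℝ) : ℂ) • (𝓕 W : Lp F 2 volume) (-y) with hK
  have hKi : Integrable K := (hC (𝓕 W)).1.comp_neg
  -- One derivative costs a factor `‖y‖ ≤ (1 + ‖y‖²)^{1/2}`, lowering the order of the weight to `s
  -- - 1`, still above half the dimension.
  have hle : ∀ y, ‖y‖ * ‖H y‖ ≤ ‖K y‖ := by
    intro y
    have h0 : (0 : ℝ) < 1 + ‖y‖ ^ 2 := by positivity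
    have h1 : ‖y‖ ≤ (1 + ‖y‖ ^ 2) ^ (1 / 2 : ℝ) := by
      rw [← Real.sqrt_eq_rpow]
      exact Real.le_sqrt_of_sq_le (by linarith)
    simp only [hH, hK, norm_smul, Complex.norm_real, norm_neg, Real.norm_eq_abs]
    rw [abs_of_pos (Real.rpow_pos_of_pos h0 _), abs_of_pos (Real.rpow_pos_of_pos h0 _),
      ← mul_assoc, show -(s - 1) / 2 = 1 / 2 + -s / 2 by ring, Real.rpow_add h0]
    gcongr
  have hvH : Integrable fun y => ‖y‖ * ‖H y‖ := by
    refine hKi.mono (by exact continuous_norm.aestronglyMeasurable.mul hHi.1.norm)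
      (Filter.Eventually.of_forall fun y => ?_)
    rw [Real.norm_eq_abs, abs_of_nonneg (by positivity)]
    exact hle y
  have hKint : ∫ y, ‖K y‖ ≤ C * ‖W‖ := by
    rw [hK, integral_neg_eq_self (fun y : E =>
      ‖(((1 + ‖y‖ ^ 2) ^ (-(s - 1) / 2) : ℝ) : ℂ) • (𝓕 W : Lp F 2 volume) y‖)]
    exact (hC (𝓕 W)).2.trans_eq (by rw [Lp.norm_fourier_eq])
  refine ⟨?_, fun x => ?_⟩
  · rw [hfH]
    refine Real.contDiff_fourier (N := 1) fun m hm => ?_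
    have hm' : m ≤ 1 := by exact_mod_cast hm
    interval_cases m
    · simpa using hHi.norm
    · simpa using hvH
  · rw [hfH, Real.fderiv_fourier hHi hvH]
    refine (VectorFourier.norm_fourierIntegral_le_integral_norm _ _ _ _ _).trans ?_
    calc ∫ v, ‖VectorFourier.fourierSMulRight (innerSL ℝ) H v‖
        ≤ ∫ v, 2 * Real.pi * ‖innerSL ℝ (E := E)‖ * ‖K v‖ := by
          refine integral_mono_of_nonneg (Filter.Eventually.of_forall fun v => norm_nonneg _)
            (hKi.norm.const_mul _) (Filter.Eventually.of_forall fun v => ?_)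
          refine (VectorFourier.norm_fourierSMulRight_le _ _ _).trans ?_
          rw [mul_assoc _ ‖v‖]
          exact mul_le_mul_of_nonneg_left (hle v) (by positivity)
      _ = 2 * Real.pi * ‖innerSL ℝ (E := E)‖ * ∫ v, ‖K v‖ := integral_const_mul _ _
      _ ≤ 2 * Real.pi * ‖innerSL ℝ (E := E)‖ * (C * ‖W‖) := by gcongr
      _ = _ := by ring

end SobolevEmbedding

/-! ### Time derivatives along a moving point. -/

open Filter Topology

/-- Along a differentiable curve, replacing the space argument of a time-dependent map by its
value at the base time changes the time derivative by the directional derivative. -/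
theorem hasDerivAt_comp_curve_sub {E F : Type*} [NormedAddCommGroup E] [NormedSpace ℝ E]
    [NormedAddCommGroup F] [NormedSpace ℝ F] {u : ℝ → E → F} {γ : ℝ → E} {γ' : E} {t : ℝ}
    (hγ : HasDerivAt γ γ' t) (hu : ∀ᶠ τ in 𝓝 t, Differentiable ℝ (u τ))
    (hDu : ∀ ε > 0, ∀ᶠ τ in 𝓝 t, ∀ x, ‖fderiv ℝ (u τ) x - fderiv ℝ (u t) x‖ ≤ ε) :
    HasDerivAt (fun τ => u τ (γ τ) - u τ (γ t)) (fderiv ℝ (u t) (γ t) γ') t := by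
  have hut : Differentiable ℝ (u t) := hu.self_of_nhds
  have h1 : HasDerivAt (fun τ => u t (γ τ) - u t (γ t)) (fderiv ℝ (u t) (γ t) γ') t :=
    ((hut (γ t)).hasFDerivAt.comp_hasDerivAt t hγ).sub_const _
  have h2 : HasDerivAt (fun τ => (u τ (γ τ) - u t (γ τ)) - (u τ (γ t) - u t (γ t))) 0 t := by
    rw [hasDerivAt_iff_isLittleO]
    simp only [sub_self, smul_zero, sub_zero]
    -- Mean value inequality: `u τ - u t` has an arbitrarily small Lipschitz constant for `τ` near
    -- `t`.
    have h3 : (fun τ => (u τ (γ τ) - u t (γ τ)) - (u τ (γ t) - u t (γ t))) =o[𝓝 t]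
        fun τ => γ τ - γ t := by
      rw [Asymptotics.isLittleO_iff]
      intro c hc
      filter_upwards [hu, hDu c hc] with τ h4 h5
      refine Convex.norm_image_sub_le_of_norm_fderiv_le (𝕜 := ℝ) (s := Set.univ)
        (f := fun x => u τ x - u t x) (fun x _ => (h4 x).sub (hut x)) (fun x _ => ?_)
        convex_univ (Set.mem_univ _) (Set.mem_univ _)
      rw [fderiv_fun_sub (h4 x) (hut x)]
      exact h5 x
    exact h3.trans_isBigO hγ.isBigO_sub
  have h3 := h1.add h2
  rw [add_zero] at h3
  refine h3.congr_of_eventuallyEq (Eventually.of_forall fun τ => ?_)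
  simp only [Pi.add_apply]
  abel

/-- The difference of the two curves is differentiable unconditionally, so differentiability passes
from either one to the other. -/
theorem hasDerivAt_comp_curve_iff {E F : Type*} [NormedAddCommGroup E] [NormedSpace ℝ E]
    [NormedAddCommGroup F] [NormedSpace ℝ F] {u : ℝ → E → F} {γ : ℝ → E} {γ' : E} {t : ℝ} {g : F}
    (hγ : HasDerivAt γ γ' t) (hu : ∀ᶠ τ in 𝓝 t, Differentiable ℝ (u τ))
    (hDu : ∀ ε > 0, ∀ᶠ τ in 𝓝 t, ∀ x, ‖fderiv ℝ (u τ) x - fderiv ℝ (u t) x‖ ≤ ε) :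
    HasDerivAt (fun τ => u τ (γ τ)) (g + fderiv ℝ (u t) (γ t) γ') t ↔
      HasDerivAt (fun τ => u τ (γ t)) g t := by
  have h := hasDerivAt_comp_curve_sub hγ hu hDu
  constructor
  · intro h'
    simpa [Pi.sub_def] using h'.sub h
  · intro h'
    simpa [Pi.add_def] using h'.add h

/-! ### Real vector fields as distributions. -/

variable {n : ℕ}

theorem norm_toComplex (y : Rn n) : ‖toComplex y‖ = ‖y‖ := by
  simp [toComplex, EuclideanSpace.norm_eq]

theorem continuous_toComplex : Continuous (toComplex : Rn n → Cn n) := by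
  unfold toComplex
  fun_prop

theorem toComplex_add (y z : Rn n) : toComplex (y + z) = toComplex y + toComplex z := by
  ext i
  simp [toComplex]

/-- The real part `ℂⁿ → ℝⁿ`. -/
def realPart : Cn n →L[ℝ] Rn n :=
  LinearMap.toContinuousLinearMap
    { toFun := fun z => WithLp.toLp 2 fun i => (z i).re
      map_add' := fun z w => by ext i; simp
      map_smul' := fun c z => by ext i; simp }

theorem realPart_toComplex (y : Rn n) : realPart (toComplex y) = y := by
  ext i
  simp [realPart, toComplex]

theorem memLp_toComplex {f : Rn n → Rn n} (hf : MemLp f 2) :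
    MemLp (fun x => toComplex (f x)) 2 :=
  hf.of_le (continuous_toComplex.comp_aestronglyMeasurable hf.1)
    (Eventually.of_forall fun x => (norm_toComplex (f x)).le)

theorem fieldDist_eq {f : Rn n → Rn n} (hf : MemLp f 2) :
    fieldDist f = Lp.toTemperedDistribution (memLp_toComplex hf).toLp :=
  dif_pos (memLp_toComplex hf)

theorem fieldDist_add {f g : Rn n → Rn n} (hf : MemLp f 2) (hg : MemLp g 2) :
    fieldDist (f + g) = fieldDist f + fieldDist g := by
  rw [fieldDist_eq hf, fieldDist_eq hg, fieldDist_eq (hf.add hg),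
    ← Lp.toTemperedDistributionCLM_apply, ← Lp.toTemperedDistributionCLM_apply,
    ← Lp.toTemperedDistributionCLM_apply, ← map_add, ← MemLp.toLp_add]
  simp only [Pi.add_apply, toComplex_add]
  rfl

theorem fieldDist_sub {f g : Rn n → Rn n} (hf : MemLp f 2) (hg : MemLp g 2) :
    fieldDist (f - g) = fieldDist f - fieldDist g := by
  rw [eq_sub_iff_add_eq, ← fieldDist_add (hf.sub hg) hg, sub_add_cancel]

/-- The Sobolev embedding of `H^s` into `C¹` for real vector fields. -/
theorem field_contDiff_of_besselPotential {s : ℝ} (hs : (n : ℝ) / 2 + 1 < s) :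
    ∃ C : ℝ, ∀ (f : Rn n → Rn n) (W : Lp (Cn n) 2 (volume : Measure (Rn n))),
      Continuous f → MemLp f 2 →
      TemperedDistribution.besselPotential (Rn n) (Cn n) s (fieldDist f) =
        Lp.toTemperedDistribution W →
      ContDiff ℝ 1 f ∧ ∀ x, ‖fderiv ℝ f x‖ ≤ C * ‖W‖ := by
  obtain ⟨C, hC⟩ := contDiff_one_of_besselPotential (E := Rn n) (F := Cn n) (s := s)
    (by simpa using hs)
  refine ⟨‖(realPart : Cn n →L[ℝ] Rn n)‖ * C, fun f W hf hf2 hW => ?_⟩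
  rw [fieldDist_eq hf2] at hW
  obtain ⟨h1, h2⟩ := hC _ (memLp_toComplex hf2) W (continuous_toComplex.comp hf) hW
  have hfre : f = realPart ∘ fun x => toComplex (f x) := by
    ext1 x
    exact (realPart_toComplex (f x)).symm
  refine ⟨hfre ▸ realPart.contDiff.comp h1, fun x => ?_⟩
  have h3 : fderiv ℝ f x = realPart.comp (fderiv ℝ (fun x => toComplex (f x)) x) := by
    conv_lhs => rw [hfre]
    exact (realPart.hasFDerivAt.comp x (h1.differentiable one_ne_zero x).hasFDerivAt).fderiv
  rw [h3, mul_assoc]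
  exact (ContinuousLinearMap.opNorm_comp_le _ _).trans
    (mul_le_mul_of_nonneg_left (h2 x) (norm_nonneg _))

section VectorField

variable {s : ℝ} {J : Set ℝ} {u : ℝ → Rn n → Rn n}

theorem IsSobolevVectorField.contDiff (hs : (n : ℝ) / 2 + 1 < s)
    (hu : IsSobolevVectorField s J u) {t : ℝ} (ht : t ∈ J) :
    ContDiff ℝ 1 (u t) ∧ ∃ C, ∀ x, ‖fderiv ℝ (u t) x‖ ≤ C := by
  obtain ⟨C, hC⟩ := field_contDiff_of_besselPotential hs
  obtain ⟨h1, U, h2, -⟩ := hu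
  obtain ⟨h3, h4⟩ := hC (u t) (U t) (h1 t ht).1 (h1 t ht).2 (h2 t ht)
  exact ⟨h3, _, h4⟩

theorem IsSobolevVectorField.eventually_fderiv_sub_le (hs : (n : ℝ) / 2 + 1 < s)
    (hJ : IsOpen J) (hu : IsSobolevVectorField s J u) {t : ℝ} (ht : t ∈ J) {ε : ℝ} (hε : 0 < ε) :
    ∀ᶠ τ in 𝓝 t, ∀ x, ‖fderiv ℝ (u τ) x - fderiv ℝ (u t) x‖ ≤ ε := by
  have hdiff : ∀ τ ∈ J, Differentiable ℝ (u τ) := fun τ hτ =>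
    (hu.contDiff hs hτ).1.differentiable one_ne_zero
  obtain ⟨C, hC⟩ := field_contDiff_of_besselPotential hs
  obtain ⟨h1, U, h2, h3⟩ := hu
  have hlim : Tendsto (fun τ => C * ‖U τ - U t‖) (𝓝 t) (𝓝 0) := by
    have h4 := ((h3.continuousAt (hJ.mem_nhds ht)).sub_const (U t)).norm.const_mul C
    simpa using h4
  filter_upwards [hJ.mem_nhds ht, hlim.eventually_le_const hε] with τ hτ hle x
  -- The embedding constant does not depend on the field, so it applies to the difference.
  have h5 := (hC (u τ - u t) (U τ - U t) ((h1 τ hτ).1.sub (h1 t ht).1)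
    ((h1 τ hτ).2.sub (h1 t ht).2) (by
      rw [fieldDist_sub (h1 τ hτ).2 (h1 t ht).2, map_sub, h2 τ hτ, h2 t ht,
        ← Lp.toTemperedDistributionCLM_apply, ← Lp.toTemperedDistributionCLM_apply,
        ← Lp.toTemperedDistributionCLM_apply, ← map_sub])).2 x
  rw [fderiv_sub (hdiff τ hτ x) (hdiff t ht x)] at h5
  exact h5.trans hle

end VectorField

/-! ### The field `∇_u u` and the spray. -/

theorem continuous_selfTransport {f : Rn n → Rn n} (hf : ContDiff ℝ 1 f) :
    Continuous (selfTransport f) :=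
  (hf.continuous_fderiv one_ne_zero).clm_apply hf.continuous

theorem memLp_selfTransport {f : Rn n → Rn n} (hf : ContDiff ℝ 1 f) (hf2 : MemLp f 2)
    {C : ℝ} (hC : ∀ x, ‖fderiv ℝ f x‖ ≤ C) : MemLp (selfTransport f) 2 :=
  hf2.of_le_mul (continuous_selfTransport hf).aestronglyMeasurable
    (Eventually.of_forall fun x => (fderiv ℝ f x).le_of_opNorm_le (hC x) _)

theorem IsFieldOf.add {f g : Rn n → Rn n} {S T : Distr n} (hf : IsFieldOf f S)
    (hg : IsFieldOf g T) : IsFieldOf (f + g) (S + T) :=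
  ⟨hf.1.add hg.1, hf.2.1.add hg.2.1, by rw [fieldDist_add hf.2.1 hg.2.1, hf.2.2, hg.2.2]⟩

theorem IsFieldOf.sub {f g : Rn n → Rn n} {S T : Distr n} (hf : IsFieldOf f S)
    (hg : IsFieldOf g T) : IsFieldOf (f - g) (S - T) :=
  ⟨hf.1.sub hg.1, hf.2.1.sub hg.2.1, by rw [fieldDist_sub hf.2.1 hg.2.1, hf.2.2, hg.2.2]⟩

/-- `S(u) = -A⁻¹ (∇_u (A u) + (∇u)ᵀ (A u) + (b - 1) div(u) A u) + ∇_u u`. -/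
theorem spray_eq (A : Distr n ≃ₗ[ℝ] Distr n) (b : ℝ) (f : Rn n → Rn n) :
    spray A b f = bRHS A b f + fieldDist (selfTransport f) := by
  simp only [spray, bRHS, commutator, map_sub, map_add, LinearEquiv.symm_apply_apply]
  abel

end BEquation

end

theorem mainTheorem8 (n : ℕ) (s r b : ℝ) (hs : (n : ℝ) / 2 + 1 < s) (hr : r ≤ s)
    (A : BEquation.Distr n ≃ₗ[ℝ] BEquation.Distr n)
    (hA : ∀ T : BEquation.Distr n, TemperedDistribution.MemSobolev s 2 T →
      TemperedDistribution.MemSobolev (s - r) 2 (A T))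
    (J : Set ℝ) (hJ_open : IsOpen J) (hJ_interval : J.OrdConnected) (hJ_zero : (0 : ℝ) ∈ J)
    (u : ℝ → BEquation.Rn n → BEquation.Rn n) (hu : BEquation.IsSobolevVectorField s J u)
    (φ : ℝ → BEquation.Rn n ≃ BEquation.Rn n) (hφ : BEquation.IsLagrangianFlow J u φ)
    (v : ℝ → BEquation.Rn n → BEquation.Rn n) (hv : ∀ t ∈ J, v t = u t ∘ φ t) :
    BEquation.IsBSolution A b J u ↔ BEquation.IsSpraySolution A b J φ v := by
  have hself : ∀ t ∈ J, BEquation.IsFieldOf (BEquation.selfTransport (u t))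
      (BEquation.fieldDist (BEquation.selfTransport (u t))) := by
    intro t ht
    obtain ⟨h1, C, hC⟩ := hu.contDiff hs ht
    exact ⟨BEquation.continuous_selfTransport h1,
      BEquation.memLp_selfTransport h1 (hu.1 t ht).2 hC, rfl⟩
  have hvφ : ∀ t ∈ J, v t ∘ (φ t).symm = u t := by
    intro t ht
    rw [hv t ht]
    ext1 x
    simp
  have hderiv : ∀ t ∈ J, ∀ (x y : BEquation.Rn n),
      HasDerivAt (fun τ => v τ x) (y + BEquation.selfTransport (u t) (φ t x)) t ↔
        HasDerivAt (fun τ => u τ (φ t x)) y t := by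
    intro t ht x y
    rw [BEquation.selfTransport, ← BEquation.hasDerivAt_comp_curve_iff (hφ.2 t ht x)
      (Filter.mem_of_superset (hJ_open.mem_nhds ht) fun τ hτ =>
        (hu.contDiff hs hτ).1.differentiable one_ne_zero)
      (fun ε hε => hu.eventually_fderiv_sub_le hs hJ_open ht hε)]
    refine Filter.EventuallyEq.hasDerivAt_iff ?_
    filter_upwards [hJ_open.mem_nhds ht] with τ hτ
    rw [hv τ hτ]
    rfl
  constructor
  · intro h
    refine ⟨fun t ht x => ?_, fun t ht => ?_⟩
    · rw [hv t ht]
      exact hφ.2 t ht x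
    · obtain ⟨g, hg, hgd⟩ := h t ht
      refine ⟨(g + BEquation.selfTransport (u t)) ∘ φ t, ⟨_, ?_, rfl⟩, fun x => ?_⟩
      · rw [hvφ t ht, BEquation.spray_eq]
        exact hg.add (hself t ht)
      · exact (hderiv t ht x _).2 (hgd _)
  · rintro ⟨-, h⟩ t ht
    obtain ⟨_, ⟨g, hg, rfl⟩, hgd⟩ := h t ht
    rw [hvφ t ht, BEquation.spray_eq] at hg
    refine ⟨g - BEquation.selfTransport (u t), ?_, fun x => ?_⟩
    · simpa using hg.sub (hself t ht)
    -- The spray equation only speaks at points `φ t y`; surjectivity makes these all of space.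
    · obtain ⟨y, rfl⟩ := (φ t).surjective x
      refine (hderiv t ht y _).1 ?_
      simpa using hgd y
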